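/- Lemma. Let $(S,\mathfrak m)$ be a Noetherian local ring (for example an excellent local ring), let $N$ be a finitely generated $S$-module, and let $f\in\mathfrak m$ be a nonzerodivisor on $S$ and on $N$. Put $R=S/(f)$ and $M=N/fN$, and let $n\ge 0$ be an integer. A finitely generated module $L$ over a Noetherian local ring $A$ is called free in codimension $n$ if $L_p$ is a free $A_p$-module for every prime $p$ of $A$ of codimension $\dim A-\dim A/p\le n$, and $L$ satisfies $(S_n)$ if $\operatorname{depth} L_p\ge\min\{n,\dim A_p\}$ for every prime $p$ of $A$ (with $\operatorname{depth} 0=\infty$). (1) If the $R$-module $M$ is free in codimension $n$, then the $S$-module $N$ is free in codimension $n$. If $S$ is catenary (for example excellent) and equidimensional ($\dim S/p=\dim S$ for every minimal prime $p$), then the same implication also holds when the codimension of a prime is understood as its height: if $M_q$ is free over $R_q$ for all primes $q$ of $R$ of height at most $n$, then $N_p$ is free over $S_p$ for all primes $p$ of $S$ of height at most $n$. (2) If the $R$-module $M$ satisfies $(S_n)$, then the $S$-module $N$ satisfies $(S_n)$. (3) If $K$ is a finitely generated $S$-module such that $f$ is a nonzerodivisor on $K$ and $\operatorname{Ext}^1_R(M,K/fK)=0$,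 then $\operatorname{Ext}^1_S(N,K)=0$, and reduction modulo $f$ induces an isomorphism of $R$-modules $\operatorname{Hom}_S(N,K)/f\operatorname{Hom}_S(N,K)\cong\operatorname{Hom}_R(M,K/fK)$. -/

import Mathlib

universe u

open scoped Pointwise

/-- The depth of a module over a local ring: the supremum of the lengths of the sequences of
elements of the maximal ideal that are weakly regular on the module. For a nonzero finite module
over a Noetherian local ring weakly regular sequences in the maximal ideal are regular, by
Nakayama's lemma; the zero module has depth `⊤`. -/
noncomputable def moduleDepth (A : Type*) [CommRing A] [IsLocalRing A]
    (M : Type*) [AddCommGroup M] [Module A M] : ℕ∞ :=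
  ⨆ (rs : List A) (_ : ∀ r ∈ rs, r ∈ IsLocalRing.maximalIdeal A)
    (_ : RingTheory.Sequence.IsWeaklyRegular M rs), (rs.length : ℕ∞)

/-- Serre's condition `(S_n)`: `depth M_p ≥ min {n, dim A_p}` for all primes `p` of `A`. -/
def SatisfiesSerre (A : Type*) [CommRing A] (M : Type*) [AddCommGroup M] [Module A M]
    (n : ℕ) : Prop :=
  ∀ (p : Ideal A) [p.IsPrime],
    min (n : WithBot ℕ∞) (ringKrullDim (Localization.AtPrime p)) ≤
      (moduleDepth (Localization.AtPrime p) (LocalizedModule p.primeCompl M) : WithBot ℕ∞)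

/-- `M` is free in codimension `n`: `M_p` is a free `A_p`-module for every prime `p` whose
codimension `dim A - dim A/p` is at most `n`. -/
def IsFreeInCodimension (A : Type*) [CommRing A] (M : Type*) [AddCommGroup M] [Module A M]
    (n : ℕ) : Prop :=
  ∀ (p : Ideal A) [p.IsPrime], ringKrullDim A ≤ ringKrullDim (A ⧸ p) + (n : WithBot ℕ∞) →
    Module.Free (Localization.AtPrime p) (LocalizedModule p.primeCompl M)

/-- `M_p` is a free `A_p`-module for every prime `p` of height at most `n`. -/
def IsFreeUpToHeight (A : Type*) [CommRing A] (M : Type*) [AddCommGroup M] [Module A M]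
    (n : ℕ) : Prop :=
  ∀ (p : Ideal A) [p.IsPrime], p.height ≤ (n : ℕ∞) →
    Module.Free (Localization.AtPrime p) (LocalizedModule p.primeCompl M)

/-- A ring is catenary if any two saturated finite chains of primes with the same ends have the
same length. (For a Noetherian ring all chains between two given primes have bounded length.) -/
def IsCatenaryRing (A : Type*) [CommRing A] : Prop :=
  ∀ c d : RelSeries {(p, q) : PrimeSpectrum A × PrimeSpectrum A | p ⋖ q},
    c.head = d.head → c.last = d.last → c.length = d.length

/-- A ring is equidimensional if `dim A/p = dim A` for every minimal prime `p`. -/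
def IsEquidimensionalRing (A : Type*) [CommRing A] : Prop :=
  ∀ p ∈ minimalPrimes A, ringKrullDim (A ⧸ p) = ringKrullDim A

/-! Primes containing $f$ are handled by Nakayama-type lifting from $R=S/(f)$; a prime $P\not\ni f$
is compared with a prime $Q\supseteq P+(f)$.

If $f\in Q$ and $q=Q/(f)$, then $M_q=N_Q/fN_Q$ (`exists_localizedModule_quotSMulTop_equiv`), with
$f$ regular on $N_Q$. Hence freeness of $M_q$ lifts to $N_Q$, and a regular sequence on $M_q$ lifts
to one on $N_Q$ that is longer by one. Freeness then passes from $N_Q$ to $N_P$ for $P\subseteq Q$.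

So (1) asks for a $Q$ such that $q$ has codimension at most that of $P$. For $\dim S-\dim S/P$, a
longest chain above $P$ can be moved so that its second term contains $f$. For heights, take $Q$
minimal over $P+(f)$: then $P\subset Q$ is saturated, and catenarity with equidimensionality gives
$\operatorname{ht}Q\le\operatorname{ht}P+1$.

For (2), the same minimal $Q$ satisfies $\operatorname{depth}N_P\ge\operatorname{depth}N_Q-1$, by
computing grade with Ext (`exists_isWeaklyRegular_of_forall_isPrime`). This loss is repaid by the
gain of $f$ itself.

For (3), take $\pi:X\to N$ onto with $X$ finite free. Vanishing of $\operatorname{Ext}^1(N,K)$ means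
that all maps $\ker\pi\to K$ extend to $X$. Since $f$ is $N$-regular, $\ker\pi$ reduces modulo $f$
to the kernel of the reduced map, so extension holds modulo $f$, and Nakayama on
$\operatorname{Hom}(\ker\pi,K)$ removes the error. The same extension property corrects lifts of
maps $N/fN\to K/fK$. -/

/-! ### Localization at nested primes -/

section Localization

variable {S : Type*} [CommRing S] (N : Type*) [AddCommGroup N] [Module S N]

/-- For primes `P ≤ Q` of `S`, the localization `N_P` is a flat base change of `N_Q`. -/
theorem exists_flat_isBaseChange_localizedModule_of_le {P Q : Ideal S} [P.IsPrime] [Q.IsPrime]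
    (hPQ : P ≤ Q) :
    ∃ (_ : Algebra (Localization.AtPrime Q) (Localization.AtPrime P))
      (_ : IsScalarTower S (Localization.AtPrime Q) (Localization.AtPrime P))
      (_ : Module (Localization.AtPrime Q) (LocalizedModule P.primeCompl N))
      (_ : IsScalarTower (Localization.AtPrime Q) (Localization.AtPrime P)
        (LocalizedModule P.primeCompl N))
      (g : LocalizedModule Q.primeCompl N →ₗ[Localization.AtPrime Q]
        LocalizedModule P.primeCompl N),
      Module.Flat (Localization.AtPrime Q) (Localization.AtPrime P) ∧
        IsBaseChange (Localization.AtPrime P) g := by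
  have hle : Q.primeCompl ≤ P.primeCompl := fun x hx h ↦ hx (hPQ h)
  let A := Localization.AtPrime Q
  let B := Localization.AtPrime P
  let NP := LocalizedModule P.primeCompl N
  let : Algebra A B := IsLocalization.localizationAlgebraOfSubmonoidLe _ _ _ _ hle
  have : IsScalarTower S A B := IsLocalization.localization_isScalarTower_of_submonoid_le ..
  let : Module A NP := Module.compHom NP (algebraMap A B)
  have : IsScalarTower A B NP := ⟨fun r r' m ↦ by
    rw [Algebra.smul_def, mul_smul]; rfl⟩
  have : IsScalarTower S A NP := ⟨fun r r' m ↦ by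
    rw [← algebraMap_smul B (r • r') m, ← algebraMap_smul B r' m, Algebra.smul_def r r', map_mul,
      ← IsScalarTower.algebraMap_apply S A B, mul_smul, algebraMap_smul]⟩
  let l : LocalizedModule Q.primeCompl N →ₗ[S] NP :=
    IsLocalizedModule.liftOfLE _ _ hle (LocalizedModule.mkLinearMap Q.primeCompl N)
      (LocalizedModule.mkLinearMap P.primeCompl N)
  let g : LocalizedModule Q.primeCompl N →ₗ[A] NP :=
    l.extendScalarsOfIsLocalization Q.primeCompl A
  refine ⟨inferInstance, inferInstance, inferInstance, inferInstance, g, ?_, ?_⟩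
  · have := IsLocalization.isLocalization_of_submonoid_le A B _ _ hle
    exact IsLocalization.flat B (P.primeCompl.map (algebraMap S A))
  · refine IsBaseChange.of_comp
      (IsLocalizedModule.isBaseChange Q.primeCompl A (LocalizedModule.mkLinearMap Q.primeCompl N)) ?_
    have hl : g.restrictScalars S ∘ₗ LocalizedModule.mkLinearMap Q.primeCompl N =
        LocalizedModule.mkLinearMap P.primeCompl N :=
      IsLocalizedModule.liftOfLE_comp _ _ hle (LocalizedModule.mkLinearMap Q.primeCompl N)
        (LocalizedModule.mkLinearMap P.primeCompl N)
    rw [hl]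
    exact IsLocalizedModule.isBaseChange P.primeCompl B _

theorem free_localizedModule_of_le {P Q : Ideal S} [P.IsPrime] [Q.IsPrime] (hPQ : P ≤ Q)
    (h : Module.Free (Localization.AtPrime Q) (LocalizedModule Q.primeCompl N)) :
    Module.Free (Localization.AtPrime P) (LocalizedModule P.primeCompl N) := by
  obtain ⟨_, _, _, _, g, -, hg⟩ := exists_flat_isBaseChange_localizedModule_of_le N hPQ
  exact .of_equiv hg.equiv

theorem exists_isWeaklyRegular_localizedModule_of_le {P Q : Ideal S} [P.IsPrime] [Q.IsPrime]
    (hPQ : P ≤ Q) (rs : List (Localization.AtPrime Q))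
    (hrs : ∀ r ∈ rs, r ∈ P.map (algebraMap S (Localization.AtPrime Q)))
    (h : RingTheory.Sequence.IsWeaklyRegular (LocalizedModule Q.primeCompl N) rs) :
    ∃ ts : List (Localization.AtPrime P), ts.length = rs.length ∧
      (∀ t ∈ ts, t ∈ IsLocalRing.maximalIdeal (Localization.AtPrime P)) ∧
      RingTheory.Sequence.IsWeaklyRegular (LocalizedModule P.primeCompl N) ts := by
  obtain ⟨_, _, _, _, g, _, hg⟩ := exists_flat_isBaseChange_localizedModule_of_le N hPQ
  refine ⟨rs.map (algebraMap _ _), by simp, ?_, h.of_flat_of_isBaseChange hg⟩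
  simp only [List.mem_map, forall_exists_index, and_imp, forall_apply_eq_imp_iff₂]
  intro r hr
  rw [← Localization.AtPrime.map_eq_maximalIdeal,
    IsScalarTower.algebraMap_eq S (Localization.AtPrime Q), ← Ideal.map_map]
  exact Ideal.mem_map_of_mem _ (hrs r hr)

end Localization

/-! ### Reduction modulo `f` commutes with localization -/

section Reduction

variable {S : Type*} [CommRing S] (N : Type*) [AddCommGroup N] [Module S N] (f : S)

theorem isBaseChange_mkQ_smul_top :
    IsBaseChange (S ⧸ Ideal.span {f}) (f • (⊤ : Submodule S N)).mkQ := by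
  refine IsBaseChange.of_equiv
    ((QuotSMulTop.equivQuotTensor f N).extendScalarsOfSurjective
      Ideal.Quotient.mk_surjective).symm fun x ↦ ?_
  rw [LinearEquiv.symm_apply_eq]
  rfl

-- The two models of the localized ring are only isomorphic, so the comparison of modules is
-- semilinear over `σ`.
attribute [local instance] RingHomInvPair.of_ringEquiv in
theorem exists_localizedModule_semilinearEquiv {R : Type*} [CommRing R] (q : Ideal R) [q.IsPrime]
    {M B W : Type*} [AddCommGroup M] [Module R M] [CommRing B] [Algebra R B]
    [IsLocalization.AtPrime B q] [AddCommGroup W] [Module R W] [Module B W] [IsScalarTower R B W]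
    (g : M →ₗ[R] W) (hg : IsBaseChange B g) :
    ∃ σ : Localization.AtPrime q ≃+* B,
      Nonempty (LocalizedModule q.primeCompl M ≃ₛₗ[(σ : Localization.AtPrime q →+* B)] W) := by
  have : IsLocalizedModule q.primeCompl g :=
    (isLocalizedModule_iff_isBaseChange q.primeCompl B g).mpr hg
  let σ := (IsLocalization.algEquiv q.primeCompl (Localization.AtPrime q) B).toRingEquiv
  refine ⟨σ, ⟨{ __ := IsLocalizedModule.iso q.primeCompl g, map_smul' := ?_ }⟩⟩
  intro r x
  obtain ⟨r, s, rfl⟩ := IsLocalization.exists_mk'_eq q.primeCompl r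
  -- The denominator `s` acts invertibly on `W`, so it can be cleared.
  apply ((Module.End.isUnit_iff _).mp (IsLocalizedModule.map_units g s)).1
  simp [σ, ← map_smul, ← smul_assoc]

variable {N} in
attribute [local instance] RingHomInvPair.of_ringEquiv in
/-- Localizing `N ⧸ f N` at a prime `q` of `S ⧸ (f)` gives the reduction modulo `f` of the
localization of `N` at the preimage of `q`. -/
theorem exists_localizedModule_quotSMulTop_equiv (q : Ideal (S ⧸ Ideal.span {f})) [q.IsPrime]
    {A V : Type*} [CommRing A] [Algebra S A]
    [IsLocalization.AtPrime A (q.comap (Ideal.Quotient.mk (Ideal.span {f})))]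
    [AddCommGroup V] [Module S V] [Module A V] [IsScalarTower S A V] (ι : N →ₗ[S] V)
    [IsLocalizedModule (q.comap (Ideal.Quotient.mk (Ideal.span {f}))).primeCompl ι] :
    ∃ σ : Localization.AtPrime q ≃+* A ⧸ Ideal.span {algebraMap S A f},
      Nonempty (LocalizedModule q.primeCompl (QuotSMulTop f N)
        ≃ₛₗ[(σ : Localization.AtPrime q →+* A ⧸ Ideal.span {algebraMap S A f})]
        QuotSMulTop (algebraMap S A f) V) := by
  let R := S ⧸ Ideal.span {f}
  let Q := q.comap (Ideal.Quotient.mk (Ideal.span {f}))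
  let f' := algebraMap S A f
  let B := A ⧸ Ideal.span {f'}
  let W := QuotSMulTop f' V
  let φ : R →+* B := Ideal.Quotient.lift (Ideal.span {f})
    ((Ideal.Quotient.mk (Ideal.span {f'})).comp (algebraMap S A)) (by
      simp only [← RingHom.mem_ker, ← SetLike.le_def]
      rw [Ideal.span_singleton_le_iff_mem, RingHom.mem_ker, RingHom.comp_apply,
        Ideal.Quotient.eq_zero_iff_mem]
      exact Ideal.mem_span_singleton_self _)
  let : Algebra R B := φ.toAlgebra
  have hmap : Q.primeCompl.map (Ideal.Quotient.mk (Ideal.span {f})) = q.primeCompl := by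
    ext x
    obtain ⟨x, rfl⟩ := Ideal.Quotient.mk_surjective x
    refine ⟨?_, fun h ↦ ⟨x, h, rfl⟩⟩
    rintro ⟨y, hy, hyx⟩
    rw [← hyx]
    exact hy
  have : IsLocalization.AtPrime B q := by
    have := IsLocalization.of_surjective Q.primeCompl A (Ideal.Quotient.mk (Ideal.span {f}))
      Ideal.Quotient.mk_surjective (S' := B) (Ideal.Quotient.mk (Ideal.span {f'}))
      Ideal.Quotient.mk_surjective rfl (by
        rw [Ideal.mk_ker, Ideal.mk_ker, Ideal.map_span, Set.image_singleton])
    rwa [hmap] at this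
  let : Module R W := Module.compHom W φ
  have : IsScalarTower R B W := ⟨fun r b w ↦ by rw [Algebra.smul_def, mul_smul]; rfl⟩
  have : IsScalarTower S R B := .of_algebraMap_eq' rfl
  have : IsScalarTower S A W := inferInstance
  have : IsScalarTower S R W := .of_algebraMap_smul fun s w ↦ algebraMap_smul A s w
  let g₀ : N →ₗ[S] W := (f' • (⊤ : Submodule A V)).mkQ.restrictScalars S ∘ₗ ι
  have hg₀ : IsBaseChange B g₀ :=
    (IsLocalizedModule.isBaseChange Q.primeCompl A ι).comp (isBaseChange_mkQ_smul_top V f')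
  let g₁ : QuotSMulTop f N →ₗ[S] W := Submodule.liftQ (f • (⊤ : Submodule S N)) g₀ (by
    rintro _ ⟨x, -, rfl⟩
    rw [LinearMap.mem_ker, DistribSMul.toLinearMap_apply, map_smul, ← algebraMap_smul A]
    exact (Submodule.Quotient.mk_eq_zero _).mpr (Submodule.smul_mem_pointwise_smul _ _ _ trivial))
  -- `N → W` and `N → N ⧸ f N` are base changes to `B` and `R`; hence so is the induced map from `R`
  -- to `B`.
  have hg : IsBaseChange B (g₁.extendScalarsOfSurjective (S := R) Ideal.Quotient.mk_surjective) :=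
    IsBaseChange.of_comp (isBaseChange_mkQ_smul_top N f) hg₀
  exact exists_localizedModule_semilinearEquiv q _ hg

end Reduction

/-! ### Freeness, height and regular sequences at the preimage of `q` -/

section Reduction

variable {S : Type*} [CommRing S] (N : Type*) [AddCommGroup N] [Module S N] {f : S}
  (q : Ideal (S ⧸ Ideal.span {f})) [q.IsPrime]

theorem algebraMap_mem_maximalIdeal_of_comap :
    algebraMap S (Localization.AtPrime (q.comap (Ideal.Quotient.mk (Ideal.span {f})))) f ∈
      IsLocalRing.maximalIdeal _ := by
  rw [IsLocalization.AtPrime.to_map_mem_maximal_iff _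
    (q.comap (Ideal.Quotient.mk (Ideal.span {f}))), Ideal.mem_comap,
    Ideal.Quotient.eq_zero_iff_mem.mpr (Ideal.mem_span_singleton_self f)]
  exact q.zero_mem

-- A finitely presented module is free once it is free modulo a regular element of the Jacobson
-- radical.
attribute [local instance] RingHomInvPair.of_ringEquiv in
theorem free_localizedModule_comap [IsNoetherianRing S] [Module.Finite S N]
    (hf : IsSMulRegular N f)
    (h : Module.Free (Localization.AtPrime q) (LocalizedModule q.primeCompl (QuotSMulTop f N))) :
    Module.Free (Localization.AtPrime (q.comap (Ideal.Quotient.mk (Ideal.span {f}))))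
      (LocalizedModule (q.comap (Ideal.Quotient.mk (Ideal.span {f}))).primeCompl N) := by
  let Q := q.comap (Ideal.Quotient.mk (Ideal.span {f}))
  obtain ⟨σ, ⟨e⟩⟩ := exists_localizedModule_quotSMulTop_equiv f q (A := Localization.AtPrime Q)
    (LocalizedModule.mkLinearMap Q.primeCompl N)
  have hfree := (Module.Free.iff_of_equiv e).mp h
  have := Module.finitePresentation_of_finite (Localization.AtPrime Q)
    (LocalizedModule Q.primeCompl N)
  exact (Module.free_quotSMulTop_iff_free _ _
    (IsLocalRing.maximalIdeal_le_jacobson _ (algebraMap_mem_maximalIdeal_of_comap q))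
    (hf.of_isLocalizedModule (Localization.AtPrime Q) Q.primeCompl
      (LocalizedModule.mkLinearMap Q.primeCompl N))).mp hfree

/-- The local ring at `q` is that at its preimage modulo a nonzerodivisor, which lowers the
dimension by at least one. -/
theorem height_add_one_le_height_comap (hf : IsSMulRegular S f) :
    q.height + 1 ≤ (q.comap (Ideal.Quotient.mk (Ideal.span {f}))).height := by
  let Q := q.comap (Ideal.Quotient.mk (Ideal.span {f}))
  obtain ⟨σ, -⟩ := exists_localizedModule_quotSMulTop_equiv f q (A := Localization.AtPrime Q)
    (Algebra.linearMap S (Localization.AtPrime Q))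
  have h1 : algebraMap S (Localization.AtPrime Q) f ∈ nonZeroDivisors _ :=
    mem_nonZeroDivisors_iff_right.mpr fun x hx ↦
      (hf.of_isLocalization (Localization.AtPrime Q) Q.primeCompl).right_eq_zero_of_smul
        (by rwa [smul_eq_mul, mul_comm])
  have h2 := ringKrullDim_quotient_succ_le_of_nonZeroDivisor h1
  rw [← ringKrullDim_eq_of_ringEquiv σ,
    IsLocalization.AtPrime.ringKrullDim_eq_height Q (Localization.AtPrime Q),
    IsLocalization.AtPrime.ringKrullDim_eq_height q (Localization.AtPrime q)] at h2
  exact_mod_cast h2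

theorem height_comap_le_height_add_one [IsNoetherianRing S] :
    (q.comap (Ideal.Quotient.mk (Ideal.span {f}))).height ≤ q.height + 1 := by
  have := Ideal.height_le_height_add_one_of_mem (r := f)
    (p := q.comap (Ideal.Quotient.mk (Ideal.span {f}))) (by
      rw [Ideal.mem_comap, Ideal.Quotient.eq_zero_iff_mem.mpr (Ideal.mem_span_singleton_self f)]
      exact q.zero_mem)
  rwa [Ideal.map_comap_of_surjective _ Ideal.Quotient.mk_surjective] at this

attribute [local instance] RingHomInvPair.of_ringEquiv in
theorem exists_isWeaklyRegular_localizedModule_comap (hf : IsSMulRegular N f)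
    (rs : List (Localization.AtPrime q)) (hrs : ∀ r ∈ rs, r ∈ IsLocalRing.maximalIdeal _)
    (h : RingTheory.Sequence.IsWeaklyRegular
      (LocalizedModule q.primeCompl (QuotSMulTop f N)) rs) :
    ∃ ts : List (Localization.AtPrime (q.comap (Ideal.Quotient.mk (Ideal.span {f})))),
      ts.length = rs.length + 1 ∧ (∀ t ∈ ts, t ∈ IsLocalRing.maximalIdeal _) ∧
      RingTheory.Sequence.IsWeaklyRegular
        (LocalizedModule (q.comap (Ideal.Quotient.mk (Ideal.span {f}))).primeCompl N) ts := by
  let Q := q.comap (Ideal.Quotient.mk (Ideal.span {f}))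
  let A := Localization.AtPrime Q
  let f' := algebraMap S A f
  obtain ⟨σ, ⟨e⟩⟩ := exists_localizedModule_quotSMulTop_equiv f q (A := A)
    (LocalizedModule.mkLinearMap Q.primeCompl N)
  have hf' : f' ∈ IsLocalRing.maximalIdeal A := algebraMap_mem_maximalIdeal_of_comap q
  -- Any lift of a nonunit is a nonunit, so the sequence lifts into the maximal ideal of `A`.
  have key : ∀ rs : List (Localization.AtPrime q), (∀ r ∈ rs, r ∈ IsLocalRing.maximalIdeal _) →
      ∃ ts : List A, ts.map (Ideal.Quotient.mk (Ideal.span {f'})) =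
        rs.map (σ : Localization.AtPrime q →+* A ⧸ Ideal.span {f'}) ∧
        ∀ t ∈ ts, t ∈ IsLocalRing.maximalIdeal A := by
    intro rs
    induction rs with
    | nil => exact fun _ ↦ ⟨[], rfl, by simp⟩
    | cons r rs ih =>
      intro hrs
      obtain ⟨ts, hts, hts'⟩ := ih fun r hr ↦ hrs r (List.mem_cons_of_mem _ hr)
      obtain ⟨t, ht⟩ := Ideal.Quotient.mk_surjective (I := Ideal.span {f'}) (σ r)
      refine ⟨t :: ts, by rw [List.map_cons, List.map_cons, hts, ht]; rfl, ?_⟩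
      rw [List.forall_mem_cons]
      refine ⟨?_, hts'⟩
      rw [IsLocalRing.mem_maximalIdeal, mem_nonunits_iff]
      intro hu
      have := hu.map (Ideal.Quotient.mk (Ideal.span {f'}))
      rw [ht, MulEquiv.isUnit_map] at this
      exact (IsLocalRing.mem_maximalIdeal _).mp (hrs r List.mem_cons_self) this
  obtain ⟨ts, hts, hts'⟩ := key rs hrs
  refine ⟨f' :: ts, ?_, by simpa using ⟨hf', hts'⟩, ?_⟩
  · simpa using congrArg List.length hts
  · refine .cons' (hf.of_isLocalizedModule A Q.primeCompl
      (LocalizedModule.mkLinearMap Q.primeCompl N)) ?_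
    rw [hts]
    exact (e.isWeaklyRegular_congr' rs).mp h

end Reduction

/-! ### Grade of a prime compared with depth -/

section Depth

open CategoryTheory CategoryTheory.Abelian RingTheory.Sequence

/-- If `x` acts injectively on `L` and `Ext^{i+1}(L ⧸ x L, W) = 0`, then `Ext^i(L, W) = 0`. -/
theorem subsingleton_ext_of_subsingleton_ext_quotSMulTop {A : Type u} [CommRing A]
    [IsNoetherianRing A] (L W : ModuleCat.{u} A) [Module.Finite A L] [Module.Finite A W] {x : A}
    (hxA : x ∈ (⊥ : Ideal A).jacobson) (hx : IsSMulRegular L x) (i : ℕ)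
    (h : Subsingleton (Ext (ModuleCat.of A (QuotSMulTop x L)) W (i + 1))) :
    Subsingleton (Ext L W i) := by
  -- In the long exact sequence of `0 → L → L → L ⧸ x L → 0`, the vanishing makes `x` surjective on
  -- `Ext L W i`; Nakayama then kills this finite module.
  have hsurj : ∀ y : Ext L W i, ∃ z : Ext L W i, x • z = y := fun y ↦ by
    obtain ⟨z, hz⟩ : ∃ z : Ext L W i, (Ext.mk₀ (x • 𝟙 L)).comp z (zero_add i) = y :=
      Ext.contravariant_sequence_exact₁ hx.smulShortComplex_shortExact W y
        (add_comm 1 i) (h.elim _ _)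
    refine ⟨z, ?_⟩
    rw [← hz, Ext.mk₀_smul, Ext.smul_comp, Ext.mk₀_id_comp]
  have hbot : (⊤ : Submodule A (Ext L W i)) = ⊥ := by
    refine Submodule.eq_bot_of_le_smul_of_le_jacobson_bot (Ideal.span {x}) ⊤
      Module.Finite.fg_top ?_ ((Ideal.span_singleton_le_iff_mem _).mpr hxA)
    intro y _
    obtain ⟨z, rfl⟩ := hsurj y
    exact Submodule.smul_mem_smul (Ideal.mem_span_singleton_self x) trivial
  exact (Submodule.subsingleton_iff A).mp (subsingleton_of_bot_eq_top hbot.symm)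

/-- If `p` is a prime of a Noetherian local ring `A` such that only the maximal ideal contains
`p` and an element `x ∉ p`, then the grade of `p` on a finite module is at least its depth
minus one. -/
theorem exists_isWeaklyRegular_of_forall_isPrime {A : Type u} [CommRing A] [IsLocalRing A]
    [IsNoetherianRing A] (W : Type u) [AddCommGroup W] [Module A W] [Module.Finite A W]
    (p : Ideal A) [p.IsPrime] {x : A} (hxp : x ∉ p) (hxm : x ∈ IsLocalRing.maximalIdeal A)
    (hp : ∀ r : Ideal A, r.IsPrime → p ≤ r → x ∈ r → IsLocalRing.maximalIdeal A ≤ r)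
    (k : ℕ) (rs : List A) (hlen : rs.length = k + 1)
    (hrs : ∀ r ∈ rs, r ∈ IsLocalRing.maximalIdeal A) (h : IsWeaklyRegular W rs) :
    ∃ ts : List A, ts.length = k ∧ (∀ t ∈ ts, t ∈ p) ∧ IsWeaklyRegular W ts := by
  -- The Ext criterion for regular sequences needs `p W ≠ W`, so the zero module is treated apart.
  rcases subsingleton_or_nontrivial W with hW | hW
  · refine ⟨List.replicate k 0, by simp, fun t ht ↦ ?_, ?_⟩
    · rw [List.eq_of_mem_replicate ht]
      exact p.zero_mem
    · refine ⟨fun i hi ↦ ?_⟩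
      exact fun a b _ ↦ Subsingleton.elim a b
  have hm : IsLocalRing.maximalIdeal A • (⊤ : Submodule A (ModuleCat.of A W)) < ⊤ :=
    (Submodule.top_ne_ideal_smul_of_le_jacobson_annihilator
      (IsLocalRing.maximalIdeal_le_jacobson _)).symm.lt_top
  have hpm : p • (⊤ : Submodule A (ModuleCat.of A W)) < ⊤ :=
    (Submodule.smul_mono_left (IsLocalRing.le_maximalIdeal_of_isPrime p)).trans_lt hm
  have hreg : IsSMulRegular (A ⧸ p) x := by
    refine IsSMulRegular.of_right_eq_zero_of_smul fun y hy ↦ ?_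
    obtain ⟨y, rfl⟩ := Ideal.Quotient.mk_surjective y
    rw [Algebra.smul_def, Ideal.Quotient.algebraMap_eq, ← map_mul,
      Ideal.Quotient.eq_zero_iff_mem] at hy
    exact Ideal.Quotient.eq_zero_iff_mem.mpr
      (((inferInstance : p.IsPrime).mem_or_mem hy).resolve_left hxp)
  have hsupp : Module.support A (A ⧸ p) = PrimeSpectrum.zeroLocus p := by
    rw [Module.support_eq_zeroLocus, Ideal.annihilator_quotient]
  have hext : ∀ i < k, Subsingleton (Ext (ModuleCat.of A (A ⧸ p)) (ModuleCat.of A W) i) := by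
    intro i hi
    refine subsingleton_ext_of_subsingleton_ext_quotSMulTop _ _
      (IsLocalRing.maximalIdeal_le_jacobson _ hxm) hreg i ?_
    refine ModuleCat.subsingleton_ext_of_exists_isRegular (IsLocalRing.maximalIdeal A) _ ?_ _ hm rs
      hrs ((IsLocalRing.isRegular_iff_isWeaklyRegular_of_subset_maximalIdeal hrs).mpr h) (i + 1)
      (by omega)
    -- The support of `A ⧸ (p + (x))` is the closed point alone, so its Ext into `W` vanishes in
    -- degrees up to `k`.
    intro r hr
    have hr' : r ∈ Module.support A (QuotSMulTop x (A ⧸ p)) := hr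
    rw [Module.support_quotSMulTop, hsupp] at hr'
    exact hp r.asIdeal r.isPrime hr'.1 (by simpa using hr'.2)
  obtain ⟨ts, hts, htp, hreg⟩ := ModuleCat.exists_isRegular_of_exists_subsingleton_ext p k
    (ModuleCat.of A W) hpm (ModuleCat.of A (A ⧸ p)) hsupp hext
  exact ⟨ts, hts, htp, hreg.toIsWeaklyRegular⟩

end Depth

/-! ### Saturated chains of primes and dimension -/

section Chains

variable {S : Type*} [CommRing S]

theorem PrimeSpectrum.coe_coheight_eq_ringKrullDim_quotient (p : PrimeSpectrum S) :
    (Order.coheight p : WithBot ℕ∞) = ringKrullDim (S ⧸ p.asIdeal) := by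
  rw [Order.coheight_eq_krullDim_Ici, ringKrullDim_quotient]
  congr

theorem covBy_of_mem_minimalPrimes [IsNoetherianRing S] {p q : PrimeSpectrum S} {x : S}
    (hx : x ∉ p.asIdeal) (hq : q.asIdeal ∈ (p.asIdeal ⊔ Ideal.span {x}).minimalPrimes) : p ⋖ q := by
  have hxq : x ∈ q.asIdeal := hq.1.2 (Ideal.mem_sup_right (Ideal.mem_span_singleton_self x))
  refine ⟨lt_of_le_of_ne (le_sup_left.trans hq.1.2) (by rintro rfl; exact hx hxq), ?_⟩
  intro r hpr hrq
  -- The middle prime of a chain whose top contains `x` can be replaced by one containing `x`; this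
  -- contradicts minimality of `q`.
  obtain ⟨t, hxt, hpt, htq⟩ := PrimeSpectrum.exist_mem_one_of_mem_two hpr hrq hxq
  exact htq.not_ge (hq.2 ⟨t.isPrime, sup_le hpt.le
    ((Ideal.span_singleton_le_iff_mem _).mpr hxt)⟩ htq.le)

/-- A saturated chain of primes has at most as many steps as the height of its last term. -/
theorem length_le_height_of_relSeries_covBy
    (t : RelSeries {(p, q) : PrimeSpectrum S × PrimeSpectrum S | p ⋖ q}) :
    (t.length : ℕ∞) ≤ t.last.asIdeal.height := by
  rw [PrimeSpectrum.height_eq_orderHeight]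
  exact Order.length_le_height (p := t.ofLE fun _ h ↦ h.lt) le_rfl

theorem le_closedPoint [IsLocalRing S] (p : PrimeSpectrum S) : p ≤ IsLocalRing.closedPoint S :=
  IsLocalRing.le_maximalIdeal_of_isPrime p.asIdeal

variable [IsNoetherianRing S] [IsLocalRing S]

/-- Any chain of primes refines to a saturated chain with the same ends. -/
theorem exists_relSeries_covBy_primeSpectrum (s : LTSeries (PrimeSpectrum S)) :
    ∃ t : RelSeries {(p, q) : PrimeSpectrum S × PrimeSpectrum S | p ⋖ q},
      t.head = s.head ∧ t.last = s.last ∧ s.length ≤ t.length := by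
  have : WellFoundedLT (PrimeSpectrum S) := 
    ⟨SetRel.IsWellFounded.of_finiteDimensional {(a, b) : PrimeSpectrum S × PrimeSpectrum S | a < b}⟩
  have : WellFoundedGT (PrimeSpectrum S) := 
    ⟨SetRel.IsWellFounded.inv_of_finiteDimensional
      {(a, b) : PrimeSpectrum S × PrimeSpectrum S | a < b}⟩
  obtain ⟨t, i, hi, h0, hl⟩ := s.exists_relSeries_covBy
  refine ⟨t, ?_, ?_, ?_⟩
  · rw [RelSeries.head, RelSeries.head, ← hi, Function.comp_apply, h0]
  · rw [RelSeries.last, RelSeries.last, ← hi, Function.comp_apply, hl]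
  · simpa using Fintype.card_le_of_embedding i

theorem exists_relSeries_covBy_of_le {p q : PrimeSpectrum S} (h : p ≤ q) :
    ∃ t : RelSeries {(p, q) : PrimeSpectrum S × PrimeSpectrum S | p ⋖ q},
      t.head = p ∧ t.last = q := by
  rcases h.eq_or_lt with rfl | h
  · exact ⟨RelSeries.singleton _ p, rfl, rfl⟩
  · obtain ⟨t, h0, hl, -⟩ := exists_relSeries_covBy_primeSpectrum
      (RelSeries.snoc (RelSeries.singleton _ p) q h)
    exact ⟨t, h0.trans (RelSeries.head_snoc ..), hl.trans (RelSeries.last_snoc ..)⟩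

/-- In a catenary equidimensional local ring all saturated chains from a minimal prime to the
maximal ideal have length `dim S`. -/
theorem length_eq_ringKrullDim_of_isCatenaryRing (hc : IsCatenaryRing S)
    (he : IsEquidimensionalRing S)
    (t : RelSeries {(p, q) : PrimeSpectrum S × PrimeSpectrum S | p ⋖ q})
    (h0 : t.head.asIdeal ∈ minimalPrimes S) (hl : t.last = IsLocalRing.closedPoint S) :
    (t.length : WithBot ℕ∞) = ringKrullDim S := by
  apply le_antisymm
  · exact Order.LTSeries.length_le_krullDim (t.ofLE fun _ h ↦ h.lt)
  obtain ⟨d, hd⟩ : ∃ d : ℕ, ringKrullDim S = d :=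
    ⟨_, (Order.krullDim_eq_length_of_finiteDimensionalOrder (α := PrimeSpectrum S))⟩
  have h1 : (d : ℕ∞) ≤ Order.coheight t.head := by
    have := (PrimeSpectrum.coe_coheight_eq_ringKrullDim_quotient t.head).trans ((he _ h0).trans hd)
    exact_mod_cast this.ge
  -- A chain of length `dim S` starting at `t.head`, saturated and prolonged to the closed point,
  -- has the length of `t` by catenarity.
  obtain ⟨s, hs, rfl⟩ := Order.exists_series_of_le_coheight _ h1
  obtain ⟨a, ha0, hal, hsa⟩ := exists_relSeries_covBy_primeSpectrum s
  obtain ⟨b, hb0, hbl⟩ := exists_relSeries_covBy_of_le (le_closedPoint s.last)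
  have := hc t (a.smash b (hal.trans hb0.symm)) (by simp [ha0, hs]) (by simp [hl, hbl])
  rw [hd, this, RelSeries.smash_length]
  exact_mod_cast hsa.trans (Nat.le_add_right _ _)

/-- Two saturated chains from minimal primes to the maximal ideal share the piece `c` above `q`: one
refines a chain realizing the height of `q`, the other passes through `p`. Both have length `dim S`,
so their parts below `q` are equally long. -/
theorem height_le_height_add_one_of_covBy (hc : IsCatenaryRing S) (he : IsEquidimensionalRing S)
    {p q : PrimeSpectrum S} (hpq : p ⋖ q) : q.asIdeal.height ≤ p.asIdeal.height + 1 := by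
  obtain ⟨n, hn⟩ := ENat.ne_top_iff_exists.mp (Ideal.height_ne_top_of_isPrime (I := q.asIdeal))
  obtain ⟨s, hs, rfl⟩ := Order.exists_series_of_le_height q
    (n := n) (by rw [← PrimeSpectrum.height_eq_orderHeight, ← hn])
  obtain ⟨c, hc0, hcl⟩ := exists_relSeries_covBy_of_le (le_closedPoint q)
  obtain ⟨a, ha0, hal, hsa⟩ := exists_relSeries_covBy_primeSpectrum s
  obtain ⟨P₀, hP₀, hP₀s⟩ := Ideal.exists_minimalPrimes_le (J := s.head.asIdeal) bot_le
  obtain ⟨P₁, hP₁, hP₁p⟩ := Ideal.exists_minimalPrimes_le (J := p.asIdeal) bot_le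
  obtain ⟨e, he0, hel⟩ := exists_relSeries_covBy_of_le
    (p := ⟨P₀, hP₀.1.1⟩) (q := s.head) hP₀s
  obtain ⟨b, hb0, hbl⟩ := exists_relSeries_covBy_of_le (p := ⟨P₁, hP₁.1.1⟩) (q := p) hP₁p
  have h1 := length_eq_ringKrullDim_of_isCatenaryRing hc he
    ((e.smash a (hel.trans ha0.symm)).smash c (by simp [hal, hs, hc0]))
    (by simpa [he0] using hP₀) (by simp [hcl])
  have h2 := length_eq_ringKrullDim_of_isCatenaryRing hc he
    ((b.snoc q (by simpa [hbl] using hpq)).smash c (by simp [hc0]))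
    (by simpa [hb0] using hP₁) (by simp [hcl])
  have h3 := length_le_height_of_relSeries_covBy b
  rw [hbl] at h3
  have h4 := h1.trans h2.symm
  simp only [RelSeries.smash_length, RelSeries.snoc_length] at h4
  norm_cast at h4
  rw [← hn]
  calc ((s.length : ℕ) : ℕ∞) ≤ (b.length + 1 : ℕ) := by exact_mod_cast (by omega)
    _ ≤ _ := by push_cast; gcongr

/-- If `f` lies in the maximal ideal but not in the prime `P`, some prime `Q ⊇ P + (f)` satisfies
`dim S/P ≤ dim S/Q + 1`. -/
theorem exists_le_ringKrullDim_quotient_add_one {f : S} (hf : f ∈ IsLocalRing.maximalIdeal S)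
    (P : PrimeSpectrum S) (hP : f ∉ P.asIdeal) :
    ∃ Q : PrimeSpectrum S, P ≤ Q ∧ f ∈ Q.asIdeal ∧
      ringKrullDim (S ⧸ P.asIdeal) ≤ ringKrullDim (S ⧸ Q.asIdeal) + 1 := by
  rw [← PrimeSpectrum.coe_coheight_eq_ringKrullDim_quotient]
  obtain ⟨d, hd⟩ : ∃ d : ℕ, Order.coheight P = d := by
    have h1 : Order.coheight P ≠ ⊤ := fun h ↦ by
      have h2 : ringKrullDim (S ⧸ P.asIdeal) ≤ ringKrullDim S := ringKrullDim_quotient_le _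
      rw [← PrimeSpectrum.coe_coheight_eq_ringKrullDim_quotient, h] at h2
      exact ringKrullDim_ne_top (R := S) (top_le_iff.mp h2)
    obtain ⟨d, hd⟩ := ENat.ne_top_iff_exists.mp h1
    exact ⟨d, hd.symm⟩
  obtain ⟨s, hs, hlen⟩ := Order.exists_series_of_le_coheight P hd.ge
  -- A longest chain above `P` ends at the maximal ideal, otherwise it could be prolonged.
  have hlast : f ∈ s.last.asIdeal := by
    by_contra hfl
    have hlt : s.last < IsLocalRing.closedPoint S :=
      lt_of_le_of_ne (le_closedPoint _)
        (by rintro h; rw [h] at hfl; exact hfl hf)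
    have := Order.length_le_coheight (p := s.snoc _ hlt) (x := P) (by simp [hs])
    rw [hd] at this
    simp [hlen] at this
    norm_cast at this
    omega
  obtain ⟨t, ht1, htl, ht0, -⟩ := PrimeSpectrum.exist_ltSeries_mem_one_of_mem_last s hlast
  refine ⟨t 1, ?_, ht1, ?_⟩
  · rw [← hs, ht0]
    exact t.head_le 1
  · rw [← PrimeSpectrum.coe_coheight_eq_ringKrullDim_quotient, hd]
    -- For a chain of length zero the index `1` would wrap around to `0`, putting `f` in `P`.
    have hpos : t.length ≠ 0 := fun h0 ↦ hP (by
      have h10 : (1 : Fin (t.length + 1)) = 0 := by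
        apply Fin.ext; simp [h0]
      rw [h10] at ht1
      rw [← hs, ht0]; exact ht1)
    have h1 : ((1 : Fin (t.length + 1)) : ℕ) = 1 := by
      rw [Fin.val_one', Nat.mod_eq_of_lt (by omega)]
    have h2 := Order.length_le_coheight (p := t.drop 1) (x := t 1) (RelSeries.head_drop ..).ge
    rw [RelSeries.drop_length, h1] at h2
    have h3 : (d : ℕ∞) ≤ Order.coheight (t 1) + 1 := by
      calc (d : ℕ∞) = (t.length - 1 : ℕ) + 1 := by norm_cast; omega
        _ ≤ _ := by gcongr
    exact_mod_cast h3

end Chains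

/-! ### First Ext through a projective presentation -/

section ExtOne

open CategoryTheory CategoryTheory.Abelian

/-- If `F → L` is a surjection from a projective module, `Ext^1(L, K) = 0` if and only if all
linear maps from its kernel to `K` extend to `F`. -/
theorem subsingleton_ext_one_iff {A : Type u} [CommRing A] {F L : Type u} (K : Type u)
    [AddCommGroup F] [Module A F] [Module.Projective A F] [AddCommGroup L] [Module A L]
    [AddCommGroup K] [Module A K] {π : F →ₗ[A] L} (hπ : Function.Surjective π) :
    Subsingleton (Ext (ModuleCat.of A L) (ModuleCat.of A K) 1) ↔
      ∀ φ : LinearMap.ker π →ₗ[A] K, ∃ ψ : F →ₗ[A] K, ψ ∘ₗ (LinearMap.ker π).subtype = φ := by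
  have hS := LinearMap.shortExact_shortComplexKer hπ
  have : CategoryTheory.Projective π.shortComplexKer.X₂ :=
    inferInstanceAs (CategoryTheory.Projective (ModuleCat.of A F))
  constructor
  · intro h φ
    obtain ⟨y, hy⟩ := Ext.contravariant_sequence_exact₁ hS (ModuleCat.of A K)
      (Ext.mk₀ (ModuleCat.ofHom φ)) (add_comm 1 0) (h.elim _ _)
    obtain ⟨ψ, rfl⟩ := (Ext.mk₀_bijective _ _).2 y
    rw [Ext.mk₀_comp_mk₀] at hy
    exact ⟨ψ.hom, congrArg ModuleCat.Hom.hom ((Ext.mk₀_bijective _ _).1 hy)⟩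
  · intro h
    refine subsingleton_of_forall_eq 0 fun x ↦ ?_
    obtain ⟨y, rfl⟩ := Ext.contravariant_sequence_exact₃ hS (ModuleCat.of A K) x
      (Ext.eq_zero_of_projective _) (add_comm 1 0)
    obtain ⟨φ, rfl⟩ := (Ext.mk₀_bijective _ _).2 y
    obtain ⟨ψ, hψ⟩ := h φ.hom
    have : φ = π.shortComplexKer.f ≫ ModuleCat.ofHom ψ := ModuleCat.hom_ext hψ.symm
    rw [this, ← Ext.mk₀_comp_mk₀, hS.extClass_comp_assoc]

end ExtOne

/-! ### Linear maps modulo `f` -/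

section Reduction

variable {S : Type*} [CommRing S] {f : S} {X N K : Type*}
  [AddCommGroup X] [Module S X] [AddCommGroup N] [Module S N] [AddCommGroup K] [Module S K]

/-- Multiplication by `f` identifies `K` with `f K`, so it can be inverted on the image of `φ`. -/
theorem exists_eq_smul_linearMap (hK : IsSMulRegular K f) (φ : X →ₗ[S] K)
    (h : ∀ x, φ x ∈ f • (⊤ : Submodule S K)) : ∃ φ' : X →ₗ[S] K, φ = f • φ' := by
  let e := LinearEquiv.ofInjective (LinearMap.lsmul S K f) hK
  have h' : ∀ x, φ x ∈ LinearMap.range (LinearMap.lsmul S K f) := fun x ↦ by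
    obtain ⟨y, -, hy⟩ := h x
    exact ⟨y, hy⟩
  refine ⟨e.symm.toLinearMap ∘ₗ φ.codRestrict _ h', LinearMap.ext fun x ↦ ?_⟩
  exact (congrArg Subtype.val (e.apply_symm_apply (φ.codRestrict _ h' x))).symm

/-- Reduction of linear maps modulo `f`, as a map to the linear maps over `S ⧸ (f)`. -/
noncomputable def QuotSMulTop.mapQuotient (f : S) (φ : N →ₗ[S] K) :
    QuotSMulTop f N →ₗ[S ⧸ Ideal.span {f}] QuotSMulTop f K :=
  (QuotSMulTop.map f φ).extendScalarsOfSurjective Ideal.Quotient.mk_surjective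

@[simp]
theorem QuotSMulTop.mapQuotient_mk (φ : N →ₗ[S] K) (x : N) :
    QuotSMulTop.mapQuotient f φ (Submodule.Quotient.mk x) = Submodule.Quotient.mk (φ x) :=
  rfl

/-- A linear map from the kernel of `π : X → N` to `K` induces a linear map from the kernel of the
reduction of `π` modulo an `N`-regular element `f` to `K ⧸ f K`. -/
theorem exists_linearMap_ker_mapQuotient (hN : IsSMulRegular N f) {π : X →ₗ[S] N}
    (hπ : Function.Surjective π) (φ : LinearMap.ker π →ₗ[S] K) :
    ∃ φ' : LinearMap.ker (QuotSMulTop.mapQuotient f π) →ₗ[S ⧸ Ideal.span {f}] QuotSMulTop f K,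
      ∀ (z : LinearMap.ker π) (y : LinearMap.ker (QuotSMulTop.mapQuotient f π)),
        (y : QuotSMulTop f X) = Submodule.Quotient.mk (z : X) →
          φ' y = Submodule.Quotient.mk (φ z) := by
  let j : LinearMap.ker π →ₗ[S] LinearMap.ker (QuotSMulTop.mapQuotient f π) :=
    { toFun z := ⟨Submodule.Quotient.mk (z : X), by
        rw [LinearMap.mem_ker, QuotSMulTop.mapQuotient_mk, LinearMap.mem_ker.mp z.2]; rfl⟩
      map_add' _ _ := rfl
      map_smul' _ _ := rfl }
  -- If `π x = f w` and `π v = w`, then `x - f v` is a representative lying in `ker π`.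
  have hj : Function.Surjective j := by
    rintro ⟨y, hy⟩
    obtain ⟨x, rfl⟩ := Submodule.Quotient.mk_surjective _ y
    rw [LinearMap.mem_ker, QuotSMulTop.mapQuotient_mk, Submodule.Quotient.mk_eq_zero] at hy
    obtain ⟨w, -, hw⟩ := hy
    obtain ⟨v, rfl⟩ := hπ w
    refine ⟨⟨x - f • v, ?_⟩, Subtype.ext ((Submodule.Quotient.eq _).mpr ?_)⟩
    · rw [LinearMap.mem_ker, map_sub, map_smul, ← hw]
      exact sub_self _
    · simpa using Submodule.smul_mem_pointwise_smul v f ⊤ trivial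
  -- Regularity of `f` on `N` puts `w` in `ker π` whenever `f w` is, so `ker j` lies in `f ker π`.
  have hker : LinearMap.ker j ≤ LinearMap.ker ((f • (⊤ : Submodule S K)).mkQ ∘ₗ φ) := by
    intro z hz
    obtain ⟨w, -, hw⟩ := (Submodule.Quotient.mk_eq_zero _).mp
      (congrArg Subtype.val (LinearMap.mem_ker.mp hz))
    have hw' : f • w = z := hw
    have hwπ : π w = 0 := hN.right_eq_zero_of_smul (by
      rw [← map_smul, hw']
      exact z.2)
    have : z = f • ⟨w, hwπ⟩ := Subtype.ext hw'.symm
    rw [LinearMap.mem_ker, LinearMap.comp_apply, this, map_smul]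
    exact (Submodule.Quotient.mk_eq_zero _).mpr (Submodule.smul_mem_pointwise_smul _ _ _ trivial)
  let g : LinearMap.ker (QuotSMulTop.mapQuotient f π) →ₗ[S] QuotSMulTop f K :=
    (LinearMap.ker j).liftQ _ hker ∘ₗ (j.quotKerEquivOfSurjective hj).symm.toLinearMap
  refine ⟨g.extendScalarsOfSurjective Ideal.Quotient.mk_surjective, fun z y hy ↦ ?_⟩
  have : y = j z := Subtype.ext hy
  subst this
  have : (j.quotKerEquivOfSurjective hj).symm (j z) = Submodule.Quotient.mk z := by
    rw [LinearEquiv.symm_apply_eq]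
    rfl
  change (LinearMap.ker j).liftQ _ hker _ = _
  rw [LinearEquiv.coe_coe, this]
  rfl

/-- If all linear maps from the kernel of the reduction of `π` modulo `f` to `K ⧸ f K` extend,
then all linear maps from the kernel of `π` to `K` extend. -/
theorem exists_extension_of_exists_extension_mapQuotient [IsNoetherianRing S]
    [Module.Projective S X] [Module.Finite S X] [Module.Finite S K]
    (hf : f ∈ (⊥ : Ideal S).jacobson) (hN : IsSMulRegular N f)
    (hK : IsSMulRegular K f) {π : X →ₗ[S] N} (hπ : Function.Surjective π)
    (H : ∀ φ : LinearMap.ker (QuotSMulTop.mapQuotient f π) →ₗ[S ⧸ Ideal.span {f}] QuotSMulTop f K,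
      ∃ ψ : QuotSMulTop f X →ₗ[S ⧸ Ideal.span {f}] QuotSMulTop f K,
        ψ ∘ₗ (LinearMap.ker (QuotSMulTop.mapQuotient f π)).subtype = φ)
    (φ : LinearMap.ker π →ₗ[S] K) :
    ∃ ψ : X →ₗ[S] K, ψ ∘ₗ (LinearMap.ker π).subtype = φ := by
  -- `T` is the submodule of extendable maps; Nakayama reduces the claim to extension up to a
  -- multiple of `f`.
  let T := LinearMap.range (LinearMap.lcomp S K (LinearMap.ker π).subtype)
  suffices h : (⊤ : Submodule S (LinearMap.ker π →ₗ[S] K)) ≤ T by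
    obtain ⟨ψ, hψ⟩ := h (x := φ) trivial
    exact ⟨ψ, hψ⟩
  refine Submodule.le_of_le_smul_of_le_jacobson_bot (I := Ideal.span {f}) Module.Finite.fg_top
    ((Ideal.span_singleton_le_iff_mem _).mpr hf) fun φ _ ↦ ?_
  obtain ⟨φ', hφ'⟩ := exists_linearMap_ker_mapQuotient hN hπ φ
  obtain ⟨ψ', hψ'⟩ := H φ'
  obtain ⟨ψ, hψ⟩ := Module.projective_lifting_property (f • (⊤ : Submodule S K)).mkQ
    (ψ'.restrictScalars S ∘ₗ (f • (⊤ : Submodule S X)).mkQ) (Submodule.mkQ_surjective _)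
  obtain ⟨φ₂, hφ₂⟩ := exists_eq_smul_linearMap hK (φ - ψ ∘ₗ (LinearMap.ker π).subtype) fun z ↦ by
    rw [← Submodule.Quotient.mk_eq_zero]
    have hz : (Submodule.Quotient.mk (z : X) : QuotSMulTop f X) ∈
        LinearMap.ker (QuotSMulTop.mapQuotient f π) := by
      rw [LinearMap.mem_ker, QuotSMulTop.mapQuotient_mk, LinearMap.mem_ker.mp z.2]; rfl
    have h1 := hφ' z ⟨_, hz⟩ rfl
    rw [← hψ'] at h1
    have h2 := LinearMap.congr_fun hψ (z : X)
    rw [LinearMap.sub_apply, Submodule.Quotient.mk_sub, ← h1, sub_eq_zero]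
    exact h2.symm
  rw [sub_eq_iff_eq_add] at hφ₂
  rw [hφ₂, add_comm]
  exact Submodule.add_mem_sup ⟨ψ, rfl⟩
    (Submodule.smul_mem_smul (Ideal.mem_span_singleton_self f) trivial)

/-- If linear maps to `K` extend from the kernel of a surjection `π : X → N` with `X` projective,
then reduction modulo a `K`-regular element `f` is an isomorphism
`Hom(N, K) / f Hom(N, K) ≅ Hom(N / f N, K / f K)`. -/
theorem exists_quotSMulTop_linearMap_equiv [Module.Projective S X] (hK : IsSMulRegular K f)
    {π : X →ₗ[S] N} (hπ : Function.Surjective π)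
    (H : ∀ φ : LinearMap.ker π →ₗ[S] K, ∃ ψ : X →ₗ[S] K, ψ ∘ₗ (LinearMap.ker π).subtype = φ) :
    ∃ e : QuotSMulTop f (N →ₗ[S] K) ≃ₗ[S ⧸ Ideal.span {f}]
        (QuotSMulTop f N →ₗ[S ⧸ Ideal.span {f}] QuotSMulTop f K),
      ∀ (φ : N →ₗ[S] K) (x : N),
        e (Submodule.Quotient.mk φ) (Submodule.Quotient.mk x) = Submodule.Quotient.mk (φ x) := by
  let red : (N →ₗ[S] K) →ₗ[S] (QuotSMulTop f N →ₗ[S ⧸ Ideal.span {f}] QuotSMulTop f K) :=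
    { toFun := QuotSMulTop.mapQuotient f
      map_add' φ ψ := by
        refine LinearMap.ext fun x ↦ ?_
        obtain ⟨x, rfl⟩ := Submodule.Quotient.mk_surjective _ x
        rfl
      map_smul' s φ := by
        refine LinearMap.ext fun x ↦ ?_
        obtain ⟨x, rfl⟩ := Submodule.Quotient.mk_surjective _ x
        rfl }
  have hred : f • (⊤ : Submodule S (N →ₗ[S] K)) ≤ LinearMap.ker red := by
    rintro _ ⟨φ, -, rfl⟩
    rw [LinearMap.mem_ker]
    refine LinearMap.ext fun x ↦ ?_
    obtain ⟨x, rfl⟩ := Submodule.Quotient.mk_surjective _ x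
    exact (Submodule.Quotient.mk_eq_zero _).mpr
      (Submodule.smul_mem_pointwise_smul (φ x) f ⊤ trivial)
  let r : QuotSMulTop f (N →ₗ[S] K) →ₗ[S ⧸ Ideal.span {f}]
      (QuotSMulTop f N →ₗ[S ⧸ Ideal.span {f}] QuotSMulTop f K) :=
    ((f • (⊤ : Submodule S (N →ₗ[S] K))).liftQ red hred).extendScalarsOfSurjective
      Ideal.Quotient.mk_surjective
  have hinj : Function.Injective r := by
    refine (injective_iff_map_eq_zero _).mpr fun φ hφ ↦ ?_
    obtain ⟨φ, rfl⟩ := Submodule.Quotient.mk_surjective _ φ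
    obtain ⟨φ', rfl⟩ := exists_eq_smul_linearMap hK φ fun x ↦
      (Submodule.Quotient.mk_eq_zero _).mp
        (LinearMap.congr_fun hφ (Submodule.Quotient.mk x))
    exact (Submodule.Quotient.mk_eq_zero _).mpr
      (Submodule.smul_mem_pointwise_smul φ' f ⊤ trivial)
  have hsurj : Function.Surjective r := by
    intro g
    obtain ⟨h, hh⟩ := Module.projective_lifting_property (f • (⊤ : Submodule S K)).mkQ
      ((g.restrictScalars S ∘ₗ (f • (⊤ : Submodule S N)).mkQ) ∘ₗ π) (Submodule.mkQ_surjective _)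
    have hh' (x : X) : (Submodule.Quotient.mk (h x) : QuotSMulTop f K) =
        g (Submodule.Quotient.mk (π x)) := LinearMap.congr_fun hh x
    obtain ⟨φ, hφ⟩ := exists_eq_smul_linearMap hK (h ∘ₗ (LinearMap.ker π).subtype) fun z ↦ by
      rw [← Submodule.Quotient.mk_eq_zero]
      refine (hh' z).trans ?_
      rw [LinearMap.mem_ker.mp z.2, Submodule.Quotient.mk_zero, map_zero]
    obtain ⟨ψ, hψ⟩ := H φ
    -- On `ker π` the lift `h` equals `f φ`; subtracting `f ψ` makes it descend to `N` without
    -- changing it modulo `f`.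
    have hle : LinearMap.ker π ≤ LinearMap.ker (h - f • ψ) := by
      intro z hz
      have h1 := LinearMap.congr_fun hφ ⟨z, hz⟩
      rw [← hψ] at h1
      exact sub_eq_zero.mpr h1
    let θ : N →ₗ[S] K := (LinearMap.ker π).liftQ (h - f • ψ) hle ∘ₗ (π.quotKerEquivOfSurjective hπ).symm.toLinearMap
    have hθ (x : X) : θ (π x) = h x - f • ψ x := by
      have : (π.quotKerEquivOfSurjective hπ).symm (π x) = Submodule.Quotient.mk x := by
        rw [LinearEquiv.symm_apply_eq]
        rfl
      change (LinearMap.ker π).liftQ _ hle ((π.quotKerEquivOfSurjective hπ).symm (π x)) = _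
      rw [this]
      rfl
    refine ⟨Submodule.Quotient.mk θ, ?_⟩
    refine LinearMap.ext fun y ↦ ?_
    obtain ⟨y, rfl⟩ := Submodule.Quotient.mk_surjective _ y
    obtain ⟨x, rfl⟩ := hπ y
    change (Submodule.Quotient.mk (θ (π x)) : QuotSMulTop f K) = _
    rw [← hh', hθ, Submodule.Quotient.mk_sub, sub_eq_self]
    exact (Submodule.Quotient.mk_eq_zero _).mpr
      (Submodule.smul_mem_pointwise_smul _ f ⊤ trivial)
  exact ⟨LinearEquiv.ofBijective r ⟨hinj, hsurj⟩, fun φ x ↦ rfl⟩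

end Reduction

/-! ### Serre's condition in terms of regular sequences -/

section Serre

/-- Initial segments of weakly regular sequences are weakly regular, so a longer sequence can be
truncated to length `j`. -/
theorem natCast_le_moduleDepth_iff (A : Type*) [CommRing A] [IsLocalRing A] (M : Type*)
    [AddCommGroup M] [Module A M] (j : ℕ) :
    (j : ℕ∞) ≤ moduleDepth A M ↔ ∃ rs : List A, rs.length = j ∧
      (∀ r ∈ rs, r ∈ IsLocalRing.maximalIdeal A) ∧
        RingTheory.Sequence.IsWeaklyRegular M rs := by
  constructor
  · intro h
    rcases j with _ | j
    · exact ⟨[], rfl, by simp, .nil A M⟩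
    have h' : (j : ℕ∞) < moduleDepth A M := lt_of_lt_of_le (by exact_mod_cast j.lt_succ_self) h
    simp only [moduleDepth, lt_iSup_iff] at h'
    obtain ⟨rs, hrs, hreg, hlen⟩ := h'
    have hlen' : j < rs.length := by exact_mod_cast hlen
    refine ⟨rs.take (j + 1), by simpa using hlen', fun r hr ↦ hrs r (List.mem_of_mem_take hr), ?_⟩
    rw [← List.take_append_drop (j + 1) rs,
      RingTheory.Sequence.isWeaklyRegular_append_iff] at hreg
    exact hreg.1
  · rintro ⟨rs, rfl, hrs, hreg⟩
    exact le_iSup_of_le rs (le_iSup_of_le hrs (le_iSup_of_le hreg le_rfl))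

theorem satisfiesSerre_iff (A : Type*) [CommRing A] [IsNoetherianRing A] (M : Type*)
    [AddCommGroup M] [Module A M] (n : ℕ) :
    SatisfiesSerre A M n ↔ ∀ (p : Ideal A) [p.IsPrime] (j : ℕ), j ≤ n → (j : ℕ∞) ≤ p.height →
      ∃ rs : List (Localization.AtPrime p), rs.length = j ∧
        (∀ r ∈ rs, r ∈ IsLocalRing.maximalIdeal (Localization.AtPrime p)) ∧
          RingTheory.Sequence.IsWeaklyRegular (LocalizedModule p.primeCompl M) rs := by
  refine forall_congr' fun p ↦ forall_congr' fun hp ↦ ?_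
  simp only [← natCast_le_moduleDepth_iff]
  rw [IsLocalization.AtPrime.ringKrullDim_eq_height p (Localization.AtPrime p)]
  obtain ⟨d, hd⟩ := ENat.ne_top_iff_exists.mp (Ideal.height_ne_top_of_isPrime (I := p))
  rw [← hd]
  constructor
  · intro h j hjn hjd
    refine le_trans ?_ (WithBot.coe_le_coe.mp (le_trans (le_of_eq ?_) h) :
      ((min n d : ℕ) : ℕ∞) ≤ _)
    · exact_mod_cast le_min hjn (by exact_mod_cast hjd)
    · rcases le_total n d with hnd | hnd
      · rw [min_eq_left hnd, min_eq_left (by exact_mod_cast hnd)]; rfl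
      · rw [min_eq_right hnd, min_eq_right (by exact_mod_cast hnd)]
  · intro h
    have := h (min n d) (min_le_left _ _) (by exact_mod_cast min_le_right _ _)
    rcases le_total n d with hnd | hnd
    · rw [min_eq_left hnd] at this
      rw [min_eq_left (by exact_mod_cast hnd)]
      exact WithBot.coe_le_coe.mpr this
    · rw [min_eq_right hnd] at this
      rw [min_eq_right (by exact_mod_cast hnd)]
      exact WithBot.coe_le_coe.mpr this

end Serre

/-! ### Ascent from `S ⧸ (f)` to `S` -/

section Deformation

theorem le_of_add_one_le_add_one {a b : WithBot ℕ∞} (h : a + 1 ≤ b + 1) : a ≤ b := by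
  induction a with
  | bot => exact bot_le
  | coe a =>
    induction b with
    | bot =>
      rw [WithBot.bot_add, le_bot_iff] at h
      exact absurd h (WithBot.coe_ne_bot (a := a + 1))
    | coe b =>
      have h' : a + 1 ≤ b + 1 := by exact_mod_cast h
      exact_mod_cast (ENat.add_le_add_iff_right ENat.one_ne_top).mp h'

variable {S : Type u} [CommRing S] {f : S}

theorem ringKrullDim_quotient_comap_mk (q : Ideal (S ⧸ Ideal.span {f})) :
    ringKrullDim (S ⧸ q.comap (Ideal.Quotient.mk (Ideal.span {f}))) =
      ringKrullDim ((S ⧸ Ideal.span {f}) ⧸ q) := by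
  let g := (Ideal.Quotient.mk q).comp (Ideal.Quotient.mk (Ideal.span {f}))
  have hg : Function.Surjective g :=
    Ideal.Quotient.mk_surjective.comp Ideal.Quotient.mk_surjective
  have hker : RingHom.ker g = q.comap (Ideal.Quotient.mk (Ideal.span {f})) := by
    rw [← RingHom.comap_ker, Ideal.mk_ker]
  rw [← hker]
  exact ringKrullDim_eq_of_ringEquiv (RingHom.quotientKerEquivOfSurjective hg)

theorem exists_isPrime_eq_comap_mk {Q : Ideal S} [Q.IsPrime] (hf : f ∈ Q) :
    ∃ (q : Ideal (S ⧸ Ideal.span {f})) (_ : q.IsPrime),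
      Q = q.comap (Ideal.Quotient.mk (Ideal.span {f})) := by
  have hle : RingHom.ker (Ideal.Quotient.mk (Ideal.span {f})) ≤ Q := by
    rwa [Ideal.mk_ker, Ideal.span_singleton_le_iff_mem]
  refine ⟨Q.map (Ideal.Quotient.mk (Ideal.span {f})),
    Ideal.map_isPrime_of_surjective Ideal.Quotient.mk_surjective hle, ?_⟩
  rw [Ideal.comap_map_of_surjective' _ Ideal.Quotient.mk_surjective, sup_eq_left.mpr hle]

theorem exists_mem_minimalPrimes_sup [IsLocalRing S] (hfm : f ∈ IsLocalRing.maximalIdeal S)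
    (P : Ideal S) [P.IsPrime] : ∃ Q : Ideal S, Q ∈ (P ⊔ Ideal.span {f}).minimalPrimes := by
  refine Set.nonempty_coe_sort.mp (Ideal.nonempty_minimalPrimes (ne_top_of_le_ne_top
    (IsLocalRing.maximalIdeal.isMaximal S).ne_top ?_))
  exact sup_le (IsLocalRing.le_maximalIdeal_of_isPrime P)
    ((Ideal.span_singleton_le_iff_mem _).mpr hfm)

variable [IsNoetherianRing S]

/-- For `P` a prime and `Q` minimal over `P + (f)` with `f ∉ P`, the depth of `N_P` is at least the
depth of `N_Q` minus one. -/
theorem exists_isWeaklyRegular_of_mem_minimalPrimes (N : Type u) [AddCommGroup N] [Module S N]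
    [Module.Finite S N] {P Q : Ideal S} [P.IsPrime] [Q.IsPrime] (hfP : f ∉ P)
    (hQ : Q ∈ (P ⊔ Ideal.span {f}).minimalPrimes) (k : ℕ) (rs : List (Localization.AtPrime Q))
    (hlen : rs.length = k + 1)
    (hrs : ∀ r ∈ rs, r ∈ IsLocalRing.maximalIdeal (Localization.AtPrime Q))
    (h : RingTheory.Sequence.IsWeaklyRegular (LocalizedModule Q.primeCompl N) rs) :
    ∃ ts : List (Localization.AtPrime P), ts.length = k ∧
      (∀ t ∈ ts, t ∈ IsLocalRing.maximalIdeal (Localization.AtPrime P)) ∧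
      RingTheory.Sequence.IsWeaklyRegular (LocalizedModule P.primeCompl N) ts := by
  have hPQ : P ≤ Q := le_sup_left.trans hQ.1.2
  have hfQ : f ∈ Q := hQ.1.2 (Ideal.mem_sup_right (Ideal.mem_span_singleton_self f))
  let A := Localization.AtPrime Q
  have hdisj : Disjoint (Q.primeCompl : Set S) (P : Set S) :=
    Set.disjoint_left.mpr fun x hx hxP ↦ hx (hPQ hxP)
  have hprime : (P.map (algebraMap S A)).IsPrime :=
    IsLocalization.isPrime_of_isPrime_disjoint Q.primeCompl A P inferInstance hdisj
  have hcomap : (P.map (algebraMap S A)).under S = P :=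
    IsLocalization.under_map_of_isPrime_disjoint Q.primeCompl A inferInstance hdisj
  -- Minimality of `Q` over `P + (f)` leaves the maximal ideal as the only prime of `A` containing
  -- both `P A` and `f`.
  obtain ⟨ts, hts, htP, hreg⟩ := exists_isWeaklyRegular_of_forall_isPrime
    (LocalizedModule Q.primeCompl N) (P.map (algebraMap S A)) (x := algebraMap S A f)
    (fun h ↦ hfP (by rw [← hcomap]; exact h))
    ((IsLocalization.AtPrime.to_map_mem_maximal_iff A Q f).mpr hfQ)
    (fun r hr hPr hfr ↦ by
      rw [← Localization.AtPrime.map_eq_maximalIdeal, Ideal.map_le_iff_le_comap]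
      refine hQ.2 ⟨hr.comap _, sup_le (Ideal.map_le_iff_le_comap.mp hPr)
        ((Ideal.span_singleton_le_iff_mem _).mpr hfr)⟩ ?_
      exact (Ideal.comap_mono (IsLocalRing.le_maximalIdeal hr.ne_top)).trans
        (Localization.AtPrime.under_maximalIdeal (I := Q)).le) k rs hlen hrs h
  obtain ⟨us, hus, husm, hureg⟩ := exists_isWeaklyRegular_localizedModule_of_le N hPQ ts htP hreg
  exact ⟨us, hus.trans hts, husm, hureg⟩

variable (N : Type u) [AddCommGroup N] [Module S N] [Module.Finite S N]

/-- Reduces both versions of (1) to finding a suitable `Q` above `P` and `f`. -/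
theorem free_localizedModule_of_mem (hfN : IsSMulRegular N f) {P Q : Ideal S} [P.IsPrime]
    [Q.IsPrime] (hPQ : P ≤ Q) (hfQ : f ∈ Q)
    (h : ∀ (q : Ideal (S ⧸ Ideal.span {f})) [q.IsPrime],
      Q = q.comap (Ideal.Quotient.mk (Ideal.span {f})) →
        Module.Free (Localization.AtPrime q) (LocalizedModule q.primeCompl (QuotSMulTop f N))) :
    Module.Free (Localization.AtPrime P) (LocalizedModule P.primeCompl N) := by
  obtain ⟨q, _, rfl⟩ := exists_isPrime_eq_comap_mk hfQ
  exact free_localizedModule_of_le N hPQ (free_localizedModule_comap N q hfN (h q rfl))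

variable [IsLocalRing S]

theorem isFreeInCodimension_of_quotSMulTop (hfm : f ∈ IsLocalRing.maximalIdeal S)
    (hfS : IsSMulRegular S f) (hfN : IsSMulRegular N f) (n : ℕ)
    (h : IsFreeInCodimension (S ⧸ Ideal.span {f}) (QuotSMulTop f N) n) :
    IsFreeInCodimension S N n := by
  intro P _ hP
  have hdim : ringKrullDim (S ⧸ Ideal.span {f}) + 1 ≤ ringKrullDim S :=
    ringKrullDim_quotient_succ_le_of_nonZeroDivisor (mem_nonZeroDivisors_iff_right.mpr fun x hx ↦
      hfS.right_eq_zero_of_smul (by rwa [smul_eq_mul, mul_comm]))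
  by_cases hfP : f ∈ P
  · refine free_localizedModule_of_mem N hfN le_rfl hfP fun q _ hq ↦ h q ?_
    rw [hq, ringKrullDim_quotient_comap_mk] at hP
    exact (ringKrullDim_quotient_le _).trans hP
  · obtain ⟨⟨Q, hQprime⟩, hPQ, hfQ, hQ⟩ :=
      exists_le_ringKrullDim_quotient_add_one hfm ⟨P, inferInstance⟩ hfP
    refine free_localizedModule_of_mem (Q := Q) N hfN hPQ hfQ fun q _ hq ↦ h q ?_
    have h1 : ringKrullDim (S ⧸ P) ≤ ringKrullDim ((S ⧸ Ideal.span {f}) ⧸ q) + 1 := by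
      rw [← ringKrullDim_quotient_comap_mk, ← hq]
      exact hQ
    have h2 : ringKrullDim (S ⧸ Ideal.span {f}) + 1 ≤
        ringKrullDim ((S ⧸ Ideal.span {f}) ⧸ q) + n + 1 := by
      rw [add_right_comm]
      exact hdim.trans (hP.trans (add_le_add_left h1 _))
    exact le_of_add_one_le_add_one h2

theorem isFreeUpToHeight_of_quotSMulTop (hfm : f ∈ IsLocalRing.maximalIdeal S)
    (hfS : IsSMulRegular S f) (hfN : IsSMulRegular N f) (hc : IsCatenaryRing S)
    (he : IsEquidimensionalRing S) (n : ℕ)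
    (h : IsFreeUpToHeight (S ⧸ Ideal.span {f}) (QuotSMulTop f N) n) :
    IsFreeUpToHeight S N n := by
  intro P _ hP
  by_cases hfP : f ∈ P
  · refine free_localizedModule_of_mem N hfN le_rfl hfP fun q _ hq ↦ h q ?_
    rw [hq] at hP
    exact le_self_add.trans ((height_add_one_le_height_comap q hfS).trans hP)
  · obtain ⟨Q, hQ⟩ := exists_mem_minimalPrimes_sup hfm P
    have := hQ.1.1
    refine free_localizedModule_of_mem (Q := Q) N hfN (le_sup_left.trans hQ.1.2)
      (hQ.1.2 (Ideal.mem_sup_right (Ideal.mem_span_singleton_self f))) fun q _ hq ↦ h q ?_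
    have h1 := height_le_height_add_one_of_covBy hc he
      (covBy_of_mem_minimalPrimes (p := ⟨P, inferInstance⟩) (q := ⟨Q, this⟩) hfP hQ)
    have h2 := height_add_one_le_height_comap q hfS
    rw [← hq] at h2
    have h3 := h2.trans (h1.trans (add_le_add_left hP 1))
    exact (ENat.add_le_add_iff_right ENat.one_ne_top).mp h3

theorem satisfiesSerre_of_quotSMulTop (hfm : f ∈ IsLocalRing.maximalIdeal S)
    (hfN : IsSMulRegular N f) (n : ℕ)
    (h : SatisfiesSerre (S ⧸ Ideal.span {f}) (QuotSMulTop f N) n) : SatisfiesSerre S N n := by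
  rw [satisfiesSerre_iff] at h ⊢
  intro P _ j hjn hjP
  by_cases hfP : f ∈ P
  · rcases j with _ | j
    · exact ⟨[], rfl, by simp, .nil _ _⟩
    obtain ⟨q, _, rfl⟩ := exists_isPrime_eq_comap_mk hfP
    have hjq : (j : ℕ∞) ≤ q.height := by
      have h1 := hjP.trans (height_comap_le_height_add_one q)
      push_cast at h1
      exact (ENat.add_le_add_iff_right ENat.one_ne_top).mp h1
    obtain ⟨rs, rfl, hrs, hreg⟩ := h q j (by omega) hjq
    exact exists_isWeaklyRegular_localizedModule_comap N q hfN rs hrs hreg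
  · obtain ⟨Q, hQ⟩ := exists_mem_minimalPrimes_sup hfm P
    have := hQ.1.1
    have hfQ : f ∈ Q := hQ.1.2 (Ideal.mem_sup_right (Ideal.mem_span_singleton_self f))
    have hPQ : P < Q := lt_of_le_of_ne (le_sup_left.trans hQ.1.2) (by rintro rfl; exact hfP hfQ)
    obtain ⟨q, _, rfl⟩ := exists_isPrime_eq_comap_mk hfQ
    have hjq : (j : ℕ∞) ≤ q.height := by
      -- The chain of bounds is `j + 1 ≤ ht P + 1 ≤ ht Q ≤ ht q + 1`, where `Q` is the preimage of
      -- `q`.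
      have h1 := (add_le_add_left hjP 1).trans ((Ideal.height_add_one_le_of_lt_of_isPrime hPQ).trans
        (height_comap_le_height_add_one q))
      exact (ENat.add_le_add_iff_right ENat.one_ne_top).mp h1
    obtain ⟨rs, hlen, hrs, hreg⟩ := h q j hjn hjq
    obtain ⟨ts, htlen, hts, htreg⟩ :=
      exists_isWeaklyRegular_localizedModule_comap N q hfN rs hrs hreg
    -- Passing to `Q` gained one element, namely `f`; descending to `P` loses one, leaving length
    -- `j`.
    exact exists_isWeaklyRegular_of_mem_minimalPrimes N hfP hQ j ts (by rw [htlen, hlen]) hts htreg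

end Deformation

theorem mainTheorem10 {S : Type u} [CommRing S] [IsLocalRing S] [IsNoetherianRing S]
    (N : Type u) [AddCommGroup N] [Module S N] [Module.Finite S N]
    (f : S) (hfm : f ∈ IsLocalRing.maximalIdeal S)
    (hfS : IsSMulRegular S f) (hfN : IsSMulRegular N f) :
    (∀ n : ℕ, IsFreeInCodimension (S ⧸ Ideal.span {f}) (QuotSMulTop f N) n →
      IsFreeInCodimension S N n) ∧
    (IsCatenaryRing S → IsEquidimensionalRing S →
      ∀ n : ℕ, IsFreeUpToHeight (S ⧸ Ideal.span {f}) (QuotSMulTop f N) n →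
        IsFreeUpToHeight S N n) ∧
    (∀ n : ℕ, SatisfiesSerre (S ⧸ Ideal.span {f}) (QuotSMulTop f N) n →
      SatisfiesSerre S N n) ∧
    (∀ (K : Type u) [AddCommGroup K] [Module S K] [Module.Finite S K],
      IsSMulRegular K f →
      Subsingleton (CategoryTheory.Abelian.Ext
        (ModuleCat.of (S ⧸ Ideal.span {f}) (QuotSMulTop f N))
        (ModuleCat.of (S ⧸ Ideal.span {f}) (QuotSMulTop f K)) 1) →
      Subsingleton (CategoryTheory.Abelian.Ext (ModuleCat.of S N) (ModuleCat.of S K) 1) ∧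
      ∃ e : QuotSMulTop f (N →ₗ[S] K) ≃ₗ[S ⧸ Ideal.span {f}]
          (QuotSMulTop f N →ₗ[S ⧸ Ideal.span {f}] QuotSMulTop f K),
        ∀ (φ : N →ₗ[S] K) (x : N),
          e (Submodule.Quotient.mk φ) (Submodule.Quotient.mk x) =
            Submodule.Quotient.mk (φ x)) := by
  refine ⟨isFreeInCodimension_of_quotSMulTop N hfm hfS hfN,
    isFreeUpToHeight_of_quotSMulTop N hfm hfS hfN,
    satisfiesSerre_of_quotSMulTop N hfm hfN, fun K _ _ _ hfK hext ↦ ?_⟩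
  -- A finite free cover of `N`; modulo `f` it is a projective module mapping onto `N ⧸ f N`, so one
  -- presentation computes both Ext groups.
  obtain ⟨n, π, hπ⟩ := Module.Finite.exists_fin' S N
  have hπ' : Function.Surjective (QuotSMulTop.mapQuotient f π) :=
    QuotSMulTop.map_surjective f hπ
  have H := exists_extension_of_exists_extension_mapQuotient
    (IsLocalRing.maximalIdeal_le_jacobson _ hfm) hfN hfK hπ
    ((subsingleton_ext_one_iff (QuotSMulTop f K) hπ').mp hext)
  exact ⟨(subsingleton_ext_one_iff K hπ).mpr H, exists_quotSMulTop_linearMap_equiv hfK hπ H⟩
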